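/- Let $K$ be a field, $n\ge 1$, $S'=K[x_1,\ldots,x_{n-1}]$ and $S=K[x_1,\ldots,x_n]$. For a finitely generated $\mathbb Z^n$-graded $S$-module $M$, a Stanley decomposition of $M$ is a presentation of the $K$-vector space $M$ as a finite direct sum $\bigoplus_{i=1}^r m_iK[Z_i]$ with $m_i\in M$ homogeneous, $Z_i\subseteq\{x_1,\ldots,x_n\}$, and $m_iK[Z_i]=\{m_if: f\in K[Z_i]\}$ a free $K[Z_i]$-module with basis $m_i$; $\operatorname{sdepth}_S M$ is the maximum over all such decompositions of $\min_i|Z_i|$ (with $\operatorname{sdepth}_S 0=\infty$), and similarly over $S'$. The depth of a nonzero module is the maximal length of a regular sequence on it inside the ideal generated by the variables. A squarefree monomial ideal is an ideal generated by (possibly no) squarefree monomials. Suppose that $\operatorname{sdepth}_{S'} V/U\ge \operatorname{depth}_{S'} V/U$ for all squarefree monomial ideals $U\subsetneq V$ of $S'$. Then for every squarefree monomial ideal $T$ of $S$: - if $T\neq 0$, then $\operatorname{sdepth}_S T\ge \operatorname{depth}_S T$; - if $T\neq S$, then $\operatorname{sdepth}_S T\ge 1+\operatorname{depth}_S S/T$.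 -/

import Mathlib

noncomputable section

/-- A squarefree monomial ideal of `K[x_i : i ∈ σ]`: an ideal generated by squarefree monomials
`∏ i ∈ s, x_i`. The zero ideal and the unit ideal are allowed. -/
def IsSquarefreeMonomialIdeal {σ K : Type*} [Field K] (I : Ideal (MvPolynomial σ K)) : Prop :=
  ∃ A : Set (Finset σ),
    I = Ideal.span ((fun s : Finset σ => ∏ i ∈ s, (MvPolynomial.X i : MvPolynomial σ K)) '' A)

/-- The depth of a (nonzero, finitely generated, graded) module `M` over `S = K[x_i : i ∈ σ]`: the
supremum of the lengths of the `M`-regular sequences in the maximal ideal `(x_i : i ∈ σ)`. -/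
def polyDepth (σ K : Type*) [Field K] (M : Type*) [AddCommGroup M]
    [Module (MvPolynomial σ K) M] : ℕ∞ :=
  ⨆ (rs : List (MvPolynomial σ K))
    (_ : (∀ r ∈ rs, r ∈ Ideal.span
        (Set.range (MvPolynomial.X : σ → MvPolynomial σ K))) ∧
      RingTheory.Sequence.IsRegular M rs), (rs.length : ℕ∞)

section Stanley

variable {σ K : Type*} [Field K] {M : Type*} [AddCommGroup M] [Module K M]
  [Module (MvPolynomial σ K) M] [IsScalarTower K (MvPolynomial σ K) M]

/-- The `K`-subspace `m K[Z]` of `M`: all elements `f • m` with `f ∈ K[Z]`. -/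
def stanleySpace (m : M) (Z : Finset σ) : Submodule K M :=
  Submodule.map ((LinearMap.toSpanSingleton (MvPolynomial σ K) M m).restrictScalars K)
    (Subalgebra.toSubmodule (MvPolynomial.supported K (Z : Set σ)))

/-- A Stanley decomposition of the multigraded module `M`, where `𝓜 a` is the homogeneous component
of multidegree `a` (all the modules considered here live in nonnegative degrees): a finite
presentation of the vector space `M` as the direct sum of subspaces `m i K[Z i]`, with `m i`
homogeneous and `m i K[Z i]` a free `K[Z i]`-module with basis `m i`. -/
structure StanleyDecomposition (𝓜 : (σ →₀ ℕ) → Submodule K M) where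
  r : ℕ
  m : Fin r → M
  Z : Fin r → Finset σ
  homogeneous : ∀ i, ∃ a, m i ∈ 𝓜 a
  free : ∀ i, ∀ f : MvPolynomial σ K, f ∈ MvPolynomial.supported K (Z i : Set σ) →
    f • m i = 0 → f = 0
  isInternal : DirectSum.IsInternal fun i => stanleySpace (K := K) (m i) (Z i)

/-- `sdepth 𝒟 = min |Z i|` (equal to `⊤` for the empty decomposition of the zero module). -/
def StanleyDecomposition.sdepth {𝓜 : (σ →₀ ℕ) → Submodule K M}
    (D : StanleyDecomposition 𝓜) : ℕ∞ :=
  ⨅ i, ((D.Z i).card : ℕ∞)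

/-- The Stanley depth of `M`: the maximum of `sdepth 𝒟` over all Stanley decompositions `𝒟`. -/
def sdepth (𝓜 : (σ →₀ ℕ) → Submodule K M) : ℕ∞ :=
  ⨆ D : StanleyDecomposition 𝓜, D.sdepth

end Stanley

section Gradings

variable {σ K : Type*} [Field K]

/-- The multigrading of an ideal `V`: the component of degree `a` is `V ∩ K x^a`. -/
def idealGrading (V : Ideal (MvPolynomial σ K)) (a : σ →₀ ℕ) : Submodule K V :=
  Submodule.comap (V.subtype.restrictScalars K)
    (LinearMap.range (MvPolynomial.monomial a : K →ₗ[K] MvPolynomial σ K))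

/-- The factor module `V / U` for ideals `U ⊆ V`. -/
abbrev Factor (U V : Ideal (MvPolynomial σ K)) : Type _ :=
  ↥V ⧸ Submodule.submoduleOf U V

/-- The multigrading of `V / U` induced by that of `V`. -/
def factorGrading (U V : Ideal (MvPolynomial σ K)) (a : σ →₀ ℕ) : Submodule K (Factor U V) :=
  Submodule.map ((Submodule.mkQ (Submodule.submoduleOf U V)).restrictScalars K) (idealGrading V a)

end Gradings

end

/-! Single out the variable `x₀`. A squarefree monomial ideal splits as `T = U ⊕ x₀V ⊕ x₀²V ⊕ ⋯`
with `U ⊆ V` squarefree in the remaining variables, so `x₀T = x₀U ⊕ x₀²V ⊕ ⋯` and `T/x₀T ≅ U ⊕ V/U`.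
Since `x₀` is regular on `T`, depth at least `k + 1` for `T` gives depth at least `k` for `T/x₀T`,
hence for both summands (`IsConeIdeal.depthGE_left`, `IsConeIdeal.depthGE_factor`). The hypothesis
then partitions the monomials of `U` and of `V \ U` into cones of dimension at least `k`. As `T =
U[x₀] ⊕ x₀(V \ U)[x₀]` on monomials, adding the direction `x₀` to every cone gives a partition for
`T` with dimensions at least `k + 1` (`HasConePartition.cons`). This is `le_sdepth_of_depthGE`.

The bound by `S/T` reduces to this one through the depth lemma for `0 → T → S → S/T → 0`
(`DepthGE.of_quotient`).

Depth is handled by weakly regular sequences on subquotients `P/Q` of a fixed module, so zero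
modules need no exception. The key fact is `DepthGE.exchange`: the depth left after dividing by a
regular element does not depend on that element. -/

noncomputable section

open Pointwise

/-! ### Depth of subquotients via weakly regular sequences. -/

section RelativeDepth

variable {R M : Type*} [CommRing R] [AddCommGroup M] [Module R M]

/-- `x` is a nonzerodivisor on `P / Q`. -/
def RegularOn (P Q : Submodule R M) (x : R) : Prop :=
  ∀ m ∈ P, x • m ∈ Q → m ∈ Q

/-- `P / Q` has a weakly regular sequence of length `k` in `I`. -/
def DepthGE (I : Ideal R) (P : Submodule R M) : ℕ → Submodule R M → Prop
  | 0, _ => True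
  | k + 1, Q => ∃ x ∈ I, RegularOn P Q x ∧ DepthGE I P k (Q ⊔ x • P)

lemma mem_sup_smul_iff {P Q : Submodule R M} {x : R} {m : M} :
    m ∈ Q ⊔ x • P ↔ ∃ p ∈ P, m - x • p ∈ Q := by
  rw [Submodule.mem_sup]
  constructor
  · rintro ⟨q, hq, z, hz, rfl⟩
    obtain ⟨p, hp, rfl⟩ := (Submodule.mem_smul_pointwise_iff_exists _ _ _).1 hz
    exact ⟨p, hp, by simpa using hq⟩
  · rintro ⟨p, hp, h⟩
    exact ⟨_, h, x • p, Submodule.smul_mem_pointwise_smul _ _ _ hp, by simp⟩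

lemma regularOn_iff_isSMulRegular {P Q : Submodule R M} {x : R} :
    RegularOn P Q x ↔ IsSMulRegular (↥P ⧸ Q.submoduleOf P) x := by
  rw [isSMulRegular_iff_right_eq_zero_of_smul]
  constructor
  · intro h m
    obtain ⟨m, rfl⟩ := Submodule.Quotient.mk_surjective _ m
    rw [← Submodule.Quotient.mk_smul, Submodule.Quotient.mk_eq_zero,
      Submodule.Quotient.mk_eq_zero]
    exact h m.1 m.2
  · intro h m hm hx
    have := h (Submodule.Quotient.mk ⟨m, hm⟩)
    rw [← Submodule.Quotient.mk_smul, Submodule.Quotient.mk_eq_zero,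
      Submodule.Quotient.mk_eq_zero] at this
    exact this hx

/-- Prime avoidance: if `I` consists of zero divisors, it lies in a single associated prime, and the
element with that annihilator is a nonzero element killed by `I`. -/
lemma exists_isSMulRegular_of_forall {N : Type*} [AddCommGroup N] [Module R N]
    [IsNoetherianRing R] [Module.Finite R N] {I : Ideal R}
    (h : ∀ m : N, (∀ a ∈ I, a • m = 0) → m = 0) : ∃ z ∈ I, IsSMulRegular N z := by
  by_contra! hc
  have hsub : (I : Set R) ⊆ ⋃ p ∈ associatedPrimes R N, (p : Set R) := by
    rw [biUnion_associatedPrimes_eq_compl_regular]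
    exact fun z hz => hc z hz
  obtain ⟨p, hp, hIp⟩ := (Ideal.subset_union_prime_finite (associatedPrimes.finite R N)
    (f := id) 0 0 fun p hp _ _ => IsAssociatedPrime.isPrime hp).1 hsub
  obtain ⟨hpp, m, hm⟩ := (isAssociatedPrime_iff_exists_injective_linearMap (I := p) (M := N)).1 hp
  have h0 : m (Ideal.Quotient.mk p 1) = 0 := by
    refine h _ fun a ha => ?_
    rw [← map_smul]
    have : a • Ideal.Quotient.mk p 1 = 0 := by
      rw [← Ideal.Quotient.mk_eq_mk, ← Submodule.Quotient.mk_smul]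
      simpa [Ideal.Quotient.eq_zero_iff_mem] using hIp ha
    rw [this, map_zero]
  have h1 := hm (h0.trans (map_zero m).symm)
  exact hpp.ne_top ((Ideal.eq_top_iff_one _).2 (Ideal.Quotient.eq_zero_iff_mem.1 h1))

/-- One `z` serves all the subquotients at once because it is chosen regular on their product. -/
lemma exists_forall_regularOn [IsNoetherianRing R] [Module.Finite R M] {ι : Type*} [Finite ι]
    {I : Ideal R} (P Q : ι → Submodule R M)
    (h : ∀ i, ∀ m ∈ P i, (∀ a ∈ I, a • m ∈ Q i) → m ∈ Q i) :
    ∃ z ∈ I, ∀ i, RegularOn (P i) (Q i) z := by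
  classical
  obtain ⟨z, hz, hreg⟩ := exists_isSMulRegular_of_forall (I := I)
    (N := ∀ i, ↥(P i) ⧸ (Q i).submoduleOf (P i)) (by
      intro m hm
      funext i
      obtain ⟨p, hp⟩ := Submodule.Quotient.mk_surjective _ (m i)
      rw [← hp]
      refine (Submodule.Quotient.mk_eq_zero _).2 (h i p.1 p.2 fun a ha => ?_)
      have := congrFun (hm a ha) i
      rw [Pi.smul_apply, ← hp, ← Submodule.Quotient.mk_smul] at this
      exact (Submodule.Quotient.mk_eq_zero (x := a • p) _).1 this)
  refine ⟨z, hz, fun i => regularOn_iff_isSMulRegular.2 ?_⟩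
  rw [isSMulRegular_iff_right_eq_zero_of_smul] at hreg ⊢
  intro m hm
  have := congrFun (hreg (Pi.single i m) (by
    rw [← Pi.single_smul, hm, Pi.single_zero])) i
  simpa using this

lemma RegularOn.swap {P Q : Submodule R M} {x z : R} (hx : RegularOn P Q x)
    (hzx : RegularOn P (Q ⊔ x • P) z) :
    RegularOn P (Q ⊔ z • P) x := by
  intro m hm h
  obtain ⟨m', hm', h1⟩ := mem_sup_smul_iff.1 h
  obtain ⟨m'', hm'', h2⟩ := mem_sup_smul_iff.1 (hzx m' hm' (mem_sup_smul_iff.2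
    ⟨m, hm, by rw [← neg_sub]; exact Q.neg_mem h1⟩))
  refine mem_sup_smul_iff.2 ⟨m'', hm'', hx _ (P.sub_mem hm (P.smul_mem _ hm'')) ?_⟩
  have : x • (m - z • m'') = (x • m - z • m') + z • (m' - x • m'') := by
    simp only [smul_sub, smul_comm x z]; abel
  rw [this]
  exact Q.add_mem h1 (Q.smul_mem _ h2)

/-- The relation `x m ≡ y m'` mod `Q` sends an element `m` killed by `I` modulo `y` to an element
`m'` killed by `I` modulo `x`; both kinds of elements represent `Ext¹(R/I, P/Q)`. If `m'` vanishes
modulo `x`, cancelling `x` makes `m` vanish modulo `y`. -/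
lemma mem_of_forall_smul_mem {I : Ideal R} {P Q : Submodule R M} {x y : R} (hxI : x ∈ I)
    (hx : RegularOn P Q x) (hy : RegularOn P Q y)
    (h : ∀ m ∈ P, (∀ b ∈ I, b • m ∈ Q ⊔ x • P) → m ∈ Q ⊔ x • P) :
    ∀ m ∈ P, (∀ b ∈ I, b • m ∈ Q ⊔ y • P) → m ∈ Q ⊔ y • P := by
  intro m hm hb
  obtain ⟨m', hm', h1⟩ := mem_sup_smul_iff.1 (hb x hxI)
  have h2 : m' ∈ Q ⊔ x • P := by
    refine h m' hm' fun b hbI => ?_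
    obtain ⟨m1, hm1, h3⟩ := mem_sup_smul_iff.1 (hb b hbI)
    refine mem_sup_smul_iff.2 ⟨m1, hm1,
      hy _ (P.sub_mem (P.smul_mem _ hm') (P.smul_mem _ hm1)) ?_⟩
    have : y • (b • m' - x • m1) = x • (b • m - y • m1) - b • (x • m - y • m') := by
      simp only [smul_sub, smul_comm x b, smul_comm y b, smul_comm y x]; abel
    rw [this]
    exact Q.sub_mem (Q.smul_mem _ h3) (Q.smul_mem _ h1)
  obtain ⟨m2, hm2, h3⟩ := mem_sup_smul_iff.1 h2
  refine mem_sup_smul_iff.2 ⟨m2, hm2, hx _ (P.sub_mem hm (P.smul_mem _ hm2)) ?_⟩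
  have : x • (m - y • m2) = (x • m - y • m') + y • (m' - x • m2) := by
    simp only [smul_sub, smul_comm x y]; abel
  rw [this]
  exact Q.add_mem h1 (Q.smul_mem _ h3)

theorem DepthGE.exchange [IsNoetherianRing R] [Module.Finite R M] {I : Ideal R}
    {P : Submodule R M} : ∀ (k : ℕ) {Q : Submodule R M} {x y : R}, x ∈ I → y ∈ I →
      RegularOn P Q x → RegularOn P Q y → DepthGE I P k (Q ⊔ x • P) →
      DepthGE I P k (Q ⊔ y • P)
  | 0, _, _, _, _, _, _, _, _ => trivial
  | k + 1, Q, x, y, hxI, hyI, hx, hy, ⟨a, haI, ha, hk⟩ => by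
    have hxP := fun m hm (h : ∀ b ∈ I, b • m ∈ Q ⊔ x • P) => ha m hm (h a haI)
    -- A `z` regular modulo both `x` and `y` links the two: replace `a` by `z` modulo `x`, swap the
    -- order, then replace `x` by `y` modulo `z`.
    obtain ⟨z, hzI, hz⟩ := exists_forall_regularOn (I := I) (fun _ : Fin 3 => P)
      ![Q, Q ⊔ x • P, Q ⊔ y • P] (by
        intro i
        fin_cases i
        · exact fun m hm h => hx m hm (h x hxI)
        · exact hxP
        · exact mem_of_forall_smul_mem hxI hx hy hxP)
    have hz1 : RegularOn P (Q ⊔ x • P) z := hz 1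
    have hz2 : RegularOn P (Q ⊔ y • P) z := hz 2
    have h1 := DepthGE.exchange k haI hzI ha hz1 hk
    rw [sup_right_comm] at h1
    have h2 := DepthGE.exchange k hxI hyI (hx.swap hz1) (hy.swap hz2) h1
    rw [sup_right_comm] at h2
    exact ⟨z, hzI, hz2, h2⟩

lemma DepthGE.sup_smul [IsNoetherianRing R] [Module.Finite R M] {I : Ideal R}
    {P Q : Submodule R M} {k : ℕ} {y : R} (h : DepthGE I P (k + 1) Q) (hyI : y ∈ I)
    (hy : RegularOn P Q y) : DepthGE I P k (Q ⊔ y • P) := by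
  obtain ⟨x, hxI, hx, hk⟩ := h
  exact DepthGE.exchange k hxI hyI hx hy hk

lemma DepthGE.mono {I : Ideal R} {P : Submodule R M} : ∀ {k l : ℕ} {Q : Submodule R M}, k ≤ l →
    DepthGE I P l Q → DepthGE I P k Q
  | 0, _, _, _, _ => trivial
  | _ + 1, 0, _, h, _ => absurd h (by simp)
  | _ + 1, _ + 1, _, h, ⟨x, hxI, hx, hk⟩ => ⟨x, hxI, hx, DepthGE.mono (Nat.le_of_succ_le_succ h) hk⟩

/-- Exactness of `0 → P/(P ∩ Q) → M/Q → M/(P + Q) → 0` survives reduction modulo `z`, since `z` is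
regular on the right-hand term. -/
lemma inf_sup_smul_top {P Q : Submodule R M} {z : R} (hz : RegularOn ⊤ (P ⊔ Q) z) :
    P ⊓ (Q ⊔ z • ⊤) = P ⊓ Q ⊔ z • P := by
  ext p
  rw [Submodule.mem_inf, mem_sup_smul_iff, mem_sup_smul_iff]
  constructor
  · rintro ⟨hp, m, -, hm⟩
    have h1 : z • m ∈ P ⊔ Q := by
      have : z • m = p - (p - z • m) := by abel
      rw [this]
      exact Submodule.sub_mem _ (Submodule.mem_sup_left hp) (Submodule.mem_sup_right hm)
    obtain ⟨p', hp', q, hq, rfl⟩ := Submodule.mem_sup.1 (hz m trivial h1)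
    refine ⟨p', hp', P.sub_mem hp (P.smul_mem _ hp'), ?_⟩
    have : p - z • p' = (p - z • (p' + q)) + z • q := by simp only [smul_add]; abel
    rw [this]
    exact Q.add_mem hm (Q.smul_mem _ hq)
  · rintro ⟨p', hp', h⟩
    refine ⟨?_, p', trivial, h.2⟩
    have : p = (p - z • p') + z • p' := by abel
    rw [this]
    exact P.add_mem h.1 (P.smul_mem _ hp')

/-- The depth lemma for `0 → P / (P ∩ Q) → M / Q → M / (P + Q) → 0`. -/
theorem DepthGE.of_quotient [IsNoetherianRing R] [Module.Finite R M] {I : Ideal R}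
    {P : Submodule R M} : ∀ (k : ℕ) {Q : Submodule R M}, DepthGE I ⊤ k (P ⊔ Q) →
      DepthGE I ⊤ (k + 1) Q → DepthGE I P (k + 1) (P ⊓ Q)
  | 0, _, _, ⟨x, hxI, hx, _⟩ =>
    ⟨x, hxI, fun m hm h => ⟨hm, hx m trivial h.2⟩, trivial⟩
  | k + 1, Q, hPQ, hQ => by
    obtain ⟨z, hzI, hz⟩ := exists_forall_regularOn (I := I) (fun _ : Fin 2 => ⊤) ![P ⊔ Q, Q] (by
      intro i
      fin_cases i
      · obtain ⟨x, hxI, hx, -⟩ := hPQ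
        exact fun m hm h => hx m hm (h x hxI)
      · obtain ⟨x, hxI, hx, -⟩ := hQ
        exact fun m hm h => hx m hm (h x hxI))
    have hz0 : RegularOn ⊤ (P ⊔ Q) z := hz 0
    have hz1 : RegularOn ⊤ Q z := hz 1
    have h1 := hPQ.sup_smul hzI hz0
    rw [sup_assoc] at h1
    have h2 := DepthGE.of_quotient k h1 (hQ.sup_smul hzI hz1)
    rw [inf_sup_smul_top hz0] at h2
    exact ⟨z, hzI, fun m hm h => ⟨hm, hz1 m trivial h.2⟩, h2⟩

/-- Depth passes to semilinear retracts. -/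
theorem DepthGE.retract {R' M' : Type*} [CommRing R'] [AddCommGroup M'] [Module R' M']
    {I : Ideal R} {I' : Ideal R'} (φ : R →+* R') (hφ : ∀ r ∈ I, φ r ∈ I')
    {P : Submodule R M} {P' : Submodule R' M'} (i : M' →+ M) (p : M →+ M')
    (hi : ∀ y ∈ P', i y ∈ P) (hp : ∀ m ∈ P, p m ∈ P') (hpi : ∀ y ∈ P', p (i y) = y) :
    ∀ (k : ℕ) {Q : Submodule R M} {Q' : Submodule R' M'}, (∀ y ∈ Q', i y ∈ Q) →
      (∀ m ∈ Q, p m ∈ Q') → (∀ r, ∀ y ∈ P', i (φ r • y) - r • i y ∈ Q) →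
      (∀ r, ∀ m ∈ P, p (r • m) - φ r • p m ∈ Q') → DepthGE I P k Q → DepthGE I' P' k Q'
  | 0, _, _, _, _, _, _, _ => trivial
  | k + 1, Q, Q', hiQ, hpQ, his, hps, ⟨r, hrI, hr, hk⟩ => by
    -- The maps are semilinear only modulo `Q` and `Q'`; these congruences persist when `Q` and `Q'`
    -- grow, so the recursion goes through.
    refine ⟨φ r, hφ r hrI, fun y hy h => ?_, DepthGE.retract φ hφ i p hi hp hpi k ?_ ?_
      (fun r y hy => Submodule.mem_sup_left (his r y hy))
      (fun r m hm => Submodule.mem_sup_left (hps r m hm)) hk⟩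
    · rw [← hpi y hy]
      refine hpQ _ (hr _ (hi y hy) ?_)
      have := Q.sub_mem (hiQ _ h) (his r y hy)
      simpa using this
    · intro y hy
      obtain ⟨y', hy', h⟩ := mem_sup_smul_iff.1 hy
      refine mem_sup_smul_iff.2 ⟨i y', hi y' hy', ?_⟩
      have := Q.add_mem (hiQ _ h) (his r y' hy')
      simpa using this
    · intro m hm
      obtain ⟨m', hm', h⟩ := mem_sup_smul_iff.1 hm
      refine mem_sup_smul_iff.2 ⟨p m', hp m' hm', ?_⟩
      have := Q'.add_mem (hpQ _ h) (hps r m' hm')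
      simpa using this

open RingTheory.Sequence in
-- The map `f` presents `N` as `P/Q`. Leaving `N` arbitrary lets the induction pass to `QuotSMulTop
-- x N` without identifying iterated quotients.
lemma depthGE_iff_exists_isWeaklyRegular {I : Ideal R} {P : Submodule R M} :
    ∀ (k : ℕ) {Q : Submodule R M} {N : Type*} [AddCommGroup N] [Module R N] (f : P →ₗ[R] N),
      Function.Surjective f → (∀ x, f x = 0 ↔ (x : M) ∈ Q) →
      (DepthGE I P k Q ↔
        ∃ rs : List R, rs.length = k ∧ (∀ r ∈ rs, r ∈ I) ∧ IsWeaklyRegular N rs)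
  | 0, _, _, _, _, _, _, _ => ⟨fun _ => ⟨[], by simp⟩, fun _ => trivial⟩
  | k + 1, Q, N, _, _, f, hf, hQ => by
    have hreg : ∀ x, RegularOn P Q x ↔ IsSMulRegular N x := by
      intro x
      rw [isSMulRegular_iff_right_eq_zero_of_smul, hf.forall]
      simp only [← map_smul, hQ]
      exact ⟨fun h m => h m m.2, fun h m hm => h ⟨m, hm⟩⟩
    have hrec : ∀ x : R, DepthGE I P k (Q ⊔ x • P) ↔ ∃ rs : List R, rs.length = k ∧
        (∀ r ∈ rs, r ∈ I) ∧ IsWeaklyRegular (QuotSMulTop x N) rs := by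
      intro x
      refine depthGE_iff_exists_isWeaklyRegular k (I := I) (P := P) (Q := Q ⊔ x • P)
        ((Submodule.mkQ (x • (⊤ : Submodule R N))) ∘ₗ f)
        ((Submodule.mkQ_surjective _).comp hf) fun m => ?_
      rw [LinearMap.comp_apply, Submodule.mkQ_apply, Submodule.Quotient.mk_eq_zero,
        Submodule.mem_smul_pointwise_iff_exists, mem_sup_smul_iff]
      constructor
      · rintro ⟨b, -, hb⟩
        obtain ⟨b, rfl⟩ := hf b
        refine ⟨b, b.2, (hQ (m - x • b)).1 ?_⟩
        rw [map_sub, map_smul, hb, sub_self]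
      · rintro ⟨b, hb, h⟩
        refine ⟨f ⟨b, hb⟩, trivial, ?_⟩
        rw [← map_smul, eq_comm, ← sub_eq_zero, ← map_sub, hQ]
        exact h
    constructor
    · rintro ⟨x, hxI, hx, hk⟩
      obtain ⟨rs, hl, hrs, hw⟩ := (hrec x).1 hk
      refine ⟨x :: rs, by simp [hl], by simpa using ⟨hxI, hrs⟩, ?_⟩
      exact (isWeaklyRegular_cons_iff N x rs).2 ⟨(hreg x).1 hx, hw⟩
    · rintro ⟨rs, hl, hrs, hw⟩
      match rs, hl, hrs, hw with
      | x :: rs, hl, hrs, hw =>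
        have hw' := (isWeaklyRegular_cons_iff N x rs).1 hw
        exact ⟨x, hrs x (by simp), (hreg x).2 hw'.1, (hrec x).2
          ⟨rs, by simpa using hl, fun r hr => hrs r (by simp [hr]), hw'.2⟩⟩

open RingTheory.Sequence in
-- A regular element avoids the minimal primes of the support, so dividing by it lowers the
-- dimension by at least one.
lemma length_le_supportDim {R : Type*} [CommRing R] : ∀ (rs : List R) {N : Type*}
    [AddCommGroup N] [Module R N] [Module.Finite R N], IsRegular N rs →
      (rs.length : WithBot ℕ∞) ≤ Module.supportDim R N
  | [], N, _, _, _, h => by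
    have : Nontrivial N := by
      by_contra hN
      rw [not_nontrivial_iff_subsingleton] at hN
      exact h.top_ne_smul (Subsingleton.elim _ _)
    have := (Module.supportDim_ne_bot_iff_nontrivial R N).2 this
    obtain ⟨d, hd⟩ := WithBot.ne_bot_iff_exists.1 this
    rw [← hd]
    exact_mod_cast zero_le
  | r :: rs, N, _, _, _, h => by
    have h' := (isRegular_cons_iff N r rs).1 h
    have h1 := length_le_supportDim rs h'.2
    have h2 := Module.supportDim_quotSMulTop_succ_le_of_notMem_minimalPrimes (R := R) (M := N)
      (x := r) (fun _ => h'.1.notMem_of_mem_minimalPrimes)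
    refine le_trans ?_ h2
    rw [List.length_cons, Nat.cast_add, Nat.cast_one]
    gcongr

end RelativeDepth

/-! ### Partitions of exponent sets into cones. -/

section Cones

variable {σ : Type*}

/-- The exponents of the monomials of `x^a K[Z]`. -/
def expCone (a : σ →₀ ℕ) (Z : Finset σ) : Set (σ →₀ ℕ) :=
  {b | a ≤ b ∧ ∀ i ∉ Z, b i = a i}

lemma self_mem_expCone (a : σ →₀ ℕ) (Z : Finset σ) : a ∈ expCone a Z :=
  ⟨le_rfl, fun _ _ => rfl⟩

/-- `A` is a finite disjoint union of cones `expCone a Z` with `k ≤ |Z|`. -/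
def HasConePartition (A : Set (σ →₀ ℕ)) (k : ℕ) : Prop :=
  ∃ (r : ℕ) (a : Fin r → σ →₀ ℕ) (Z : Fin r → Finset σ), (∀ i, k ≤ (Z i).card) ∧
    (∀ i, expCone (a i) (Z i) ⊆ A) ∧ ∀ b ∈ A, ∃! i, b ∈ expCone (a i) (Z i)

lemma HasConePartition.of_finite {ι : Type*} [Finite ι] {A : Set (σ →₀ ℕ)} {k : ℕ}
    (a : ι → σ →₀ ℕ) (Z : ι → Finset σ) (hk : ∀ i, k ≤ (Z i).card)
    (hA : ∀ i, expCone (a i) (Z i) ⊆ A) (h : ∀ b ∈ A, ∃! i, b ∈ expCone (a i) (Z i)) :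
    HasConePartition A k := by
  let e := (Finite.equivFin ι).symm
  refine ⟨Nat.card ι, a ∘ e, Z ∘ e, fun i => hk _, fun i => hA _, fun b hb => ?_⟩
  obtain ⟨i, hi, hu⟩ := h b hb
  exact ⟨e.symm i, by simpa using hi, fun j hj => by rw [← hu _ hj]; simp⟩

lemma hasConePartition_empty (k : ℕ) : HasConePartition (∅ : Set (σ →₀ ℕ)) k :=
  ⟨0, Fin.elim0, Fin.elim0, fun i => i.elim0, fun i => i.elim0, fun _ h => h.elim⟩

/-- The exponent of the squarefree monomial with support `s`. -/
def squarefreeExp (s : Finset σ) : σ →₀ ℕ :=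
  Finsupp.indicator s fun _ _ => 1

lemma support_squarefreeExp (s : Finset σ) : (squarefreeExp s).support = s := by
  classical
  ext i
  simp [squarefreeExp, Finsupp.indicator_apply]

lemma squarefreeExp_le_iff {s : Finset σ} {b : σ →₀ ℕ} : squarefreeExp s ≤ b ↔ s ⊆ b.support := by
  classical
  rw [Finsupp.le_def]
  constructor
  · intro h i hi
    have := h i
    simp [squarefreeExp, Finsupp.indicator_apply, hi] at this
    simp only [Finsupp.mem_support_iff]; omega
  · intro h i
    by_cases hi : i ∈ s
    · have := Finsupp.mem_support_iff.1 (h hi)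
      simp [squarefreeExp, Finsupp.indicator_apply, hi]; omega
    · simp [squarefreeExp, Finsupp.indicator_apply, hi]

lemma mem_expCone_squarefreeExp {s : Finset σ} {b : σ →₀ ℕ} :
    b ∈ expCone (squarefreeExp s) s ↔ b.support = s := by
  rw [expCone, Set.mem_ofPred_eq, squarefreeExp_le_iff]
  have h0 : ∀ i ∉ s, squarefreeExp s i = 0 := fun i hi => by
    rwa [← Finsupp.notMem_support_iff, support_squarefreeExp]
  constructor
  · rintro ⟨h1, h2⟩
    refine (Finset.Subset.antisymm h1 fun i hi => ?_).symm
    by_contra hs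
    exact Finsupp.mem_support_iff.1 hi ((h2 i hs).trans (h0 i hs))
  · rintro rfl
    exact ⟨subset_rfl, fun i hi => by rw [h0 i hi, Finsupp.notMem_support_iff.1 hi]⟩

/-- Grouping exponents by support gives a finite partition: those with support `s` form the cone
with apex `squarefreeExp s` and directions `s`. -/
lemma hasConePartition_zero [Finite σ] {A : Set (σ →₀ ℕ)}
    (hA : ∀ b c : σ →₀ ℕ, b.support = c.support → b ∈ A → c ∈ A) : HasConePartition A 0 := by
  refine HasConePartition.of_finite (ι := {s : Finset σ // squarefreeExp s ∈ A})
    (fun s => squarefreeExp s.1) (fun s => s.1) (fun _ => Nat.zero_le _) ?_ ?_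
  · intro s b hb
    rw [mem_expCone_squarefreeExp] at hb
    exact hA _ _ ((support_squarefreeExp _).trans hb.symm) s.2
  · intro b hb
    exact ⟨⟨b.support, hA _ _ (support_squarefreeExp _).symm hb⟩, mem_expCone_squarefreeExp.2 rfl,
      fun s hs => Subtype.ext (mem_expCone_squarefreeExp.1 hs).symm⟩

lemma mem_expCone_cons {n k : ℕ} {a : Fin n →₀ ℕ} {Z : Finset (Fin n)} {b : Fin (n + 1) →₀ ℕ} :
    b ∈ expCone (a.cons k) (Finset.cons 0 (Z.map (Fin.succEmb n)) (by simp)) ↔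
      k ≤ b 0 ∧ b.tail ∈ expCone a Z := by
  simp only [expCone, Set.mem_ofPred_eq, Finsupp.le_def, Fin.forall_fin_succ, Finsupp.cons_zero,
    Finsupp.cons_succ, Finset.mem_cons, Finset.mem_map, Finsupp.tail_apply]
  simp [and_assoc]

/-- A cone partition of `U ∪ x₀ V`, from partitions of `U` and `V \ U`. -/
lemma HasConePartition.cons {n k : ℕ} {U V : Set (Fin n →₀ ℕ)} (hU : HasConePartition U k)
    (hV : HasConePartition (V \ U) k) (hUV : U ⊆ V) :
    HasConePartition {b : Fin (n + 1) →₀ ℕ | b.tail ∈ V ∧ (b 0 = 0 → b.tail ∈ U)} (k + 1) := by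
  obtain ⟨r, a, Z, hk, hA, hP⟩ := hU
  obtain ⟨r', a', Z', hk', hA', hP'⟩ := hV
  -- Cones of `U` start at height 0 in the new direction, those of `V \ U` at height 1.
  refine HasConePartition.of_finite (ι := Fin r ⊕ Fin r')
    (Sum.elim (fun i => (a i).cons 0) (fun i => (a' i).cons 1))
    (Sum.elim (fun i => Finset.cons 0 ((Z i).map (Fin.succEmb n)) (by simp))
      (fun i => Finset.cons 0 ((Z' i).map (Fin.succEmb n)) (by simp))) ?_ ?_ ?_
  · rintro (i | i)
    · simpa using hk i
    · simpa using hk' i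
  · rintro (i | i) b hb
    · have h := mem_expCone_cons.1 hb
      exact ⟨hUV (hA i h.2), fun _ => hA i h.2⟩
    · have h := mem_expCone_cons.1 hb
      exact ⟨(hA' i h.2).1, fun h0 => absurd h.1 (by omega)⟩
  · rintro b ⟨hbV, hbU⟩
    by_cases hb : b.tail ∈ U
    · obtain ⟨i, hi, hu⟩ := hP _ hb
      refine ⟨Sum.inl i, mem_expCone_cons.2 ⟨Nat.zero_le _, hi⟩, ?_⟩
      rintro (j | j) hj
      · exact congrArg _ (hu j (mem_expCone_cons.1 hj).2)
      · exact absurd hb (hA' j (mem_expCone_cons.1 hj).2).2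
    · obtain ⟨i, hi, hu⟩ := hP' _ ⟨hbV, hb⟩
      refine ⟨Sum.inr i, mem_expCone_cons.2 ⟨Nat.one_le_iff_ne_zero.2 fun h => hb (hbU h), hi⟩, ?_⟩
      rintro (j | j) hj
      · exact absurd (hA j (mem_expCone_cons.1 hj).2) hb
      · exact congrArg _ (hu j (mem_expCone_cons.1 hj).2)

end Cones

/-! ### Squarefree monomial ideals and their exponent sets. -/

section MonomialIdeals

open MvPolynomial

variable {σ K : Type*} [Field K]

/-- The exponents of the monomials in the ideal `I`. -/
def exps (I : Ideal (MvPolynomial σ K)) : Set (σ →₀ ℕ) :=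
  {b | monomial b 1 ∈ I}

lemma monomial_mem_iff {I : Ideal (MvPolynomial σ K)} {b : σ →₀ ℕ} {c : K} (hc : c ≠ 0) :
    monomial b c ∈ I ↔ b ∈ exps I := by
  rw [exps, Set.mem_ofPred_eq]
  constructor <;> intro h
  · simpa [C_mul_monomial, hc] using I.mul_mem_left (C c⁻¹) h
  · simpa [C_mul_monomial] using I.mul_mem_left (C c) h

lemma prod_X_eq_monomial (s : Finset σ) :
    ∏ i ∈ s, (X i : MvPolynomial σ K) = monomial (squarefreeExp s) 1 := by
  classical
  rw [monomial_eq, C_1, one_mul, Finsupp.prod, support_squarefreeExp]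
  refine Finset.prod_congr rfl fun i hi => ?_
  simp [squarefreeExp, Finsupp.indicator_apply, hi]

lemma mem_span_prod_X_iff {A : Set (Finset σ)} {f : MvPolynomial σ K} :
    f ∈ Ideal.span ((fun s : Finset σ => ∏ i ∈ s, (X i : MvPolynomial σ K)) '' A) ↔
      ∀ b ∈ f.support, ∃ s ∈ A, s ⊆ b.support := by
  simp only [prod_X_eq_monomial]
  rw [← Set.image_image (fun a => monomial a (1 : K)) squarefreeExp, mem_ideal_span_monomial_image]
  simp [squarefreeExp_le_iff]

lemma mem_exps_span_prod_X_iff {A : Set (Finset σ)} {b : σ →₀ ℕ} :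
    b ∈ exps (Ideal.span ((fun s : Finset σ => ∏ i ∈ s, (X i : MvPolynomial σ K)) '' A)) ↔
      ∃ s ∈ A, s ⊆ b.support := by
  classical
  rw [exps, Set.mem_ofPred_eq, mem_span_prod_X_iff, support_monomial, if_neg one_ne_zero]
  simp

lemma IsSquarefreeMonomialIdeal.mem_iff {I : Ideal (MvPolynomial σ K)}
    (hI : IsSquarefreeMonomialIdeal I) {f : MvPolynomial σ K} :
    f ∈ I ↔ ∀ b ∈ f.support, b ∈ exps I := by
  obtain ⟨A, rfl⟩ := hI
  simp only [mem_span_prod_X_iff, mem_exps_span_prod_X_iff]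

lemma IsSquarefreeMonomialIdeal.mem_exps_of_support_subset {I : Ideal (MvPolynomial σ K)}
    (hI : IsSquarefreeMonomialIdeal I) {b c : σ →₀ ℕ} (hb : b ∈ exps I)
    (h : b.support ⊆ c.support) : c ∈ exps I := by
  obtain ⟨A, rfl⟩ := hI
  rw [mem_exps_span_prod_X_iff] at hb ⊢
  obtain ⟨s, hs, hsb⟩ := hb
  exact ⟨s, hs, hsb.trans h⟩

lemma isSquarefreeMonomialIdeal_bot : IsSquarefreeMonomialIdeal (⊥ : Ideal (MvPolynomial σ K)) :=
  ⟨∅, by simp⟩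

@[simp]
lemma exps_bot : exps (⊥ : Ideal (MvPolynomial σ K)) = ∅ := by
  ext b
  simp [exps]

/-- A support-closed set of exponents is the set of exponents of a squarefree monomial ideal. -/
lemma exists_isSquarefreeMonomialIdeal_exps_eq {B : Set (σ →₀ ℕ)}
    (hB : ∀ b c : σ →₀ ℕ, b ∈ B → b.support ⊆ c.support → c ∈ B) :
    ∃ I : Ideal (MvPolynomial σ K), IsSquarefreeMonomialIdeal I ∧ exps I = B := by
  refine ⟨_, ⟨{s | squarefreeExp s ∈ B}, rfl⟩, Set.ext fun b => ?_⟩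
  rw [mem_exps_span_prod_X_iff]
  constructor
  · rintro ⟨s, hs, hsb⟩
    exact hB _ _ hs (by rwa [support_squarefreeExp])
  · intro hb
    exact ⟨b.support, hB _ _ hb (by rw [support_squarefreeExp]), subset_rfl⟩

lemma IsSquarefreeMonomialIdeal.le_iff {I J : Ideal (MvPolynomial σ K)}
    (hI : IsSquarefreeMonomialIdeal I) (hJ : IsSquarefreeMonomialIdeal J) :
    I ≤ J ↔ exps I ⊆ exps J :=
  ⟨fun h _ hb => h hb, fun h _ hf => hJ.mem_iff.2 fun b hb => h (hI.mem_iff.1 hf b hb)⟩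

end MonomialIdeals

/-! ### Stanley decompositions versus cone partitions. -/

section StanleyPartition

open MvPolynomial

variable {σ K : Type*} [Field K]

lemma mem_stanleySpace {M : Type*} [AddCommGroup M] [Module K M]
    [Module (MvPolynomial σ K) M] [IsScalarTower K (MvPolynomial σ K) M] {m v : M}
    {Z : Finset σ} : v ∈ stanleySpace (K := K) m Z ↔
      ∃ f ∈ MvPolynomial.supported K (Z : Set σ), f • m = v := by
  simp [stanleySpace]

lemma monomial_sub_mem_supported {a b : σ →₀ ℕ} {Z : Finset σ} (h : b ∈ expCone a Z) (c : K) :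
    monomial (b - a) c ∈ MvPolynomial.supported K (Z : Set σ) := by
  classical
  by_cases hc : c = 0
  · simp [hc]
  rw [mem_supported, vars_monomial hc]
  intro i hi
  by_contra hZ
  have := h.2 i hZ
  simp [Finsupp.tsub_apply, this] at hi

lemma support_mul_monomial_subset {a : σ →₀ ℕ} {Z : Finset σ} {f : MvPolynomial σ K}
    (hf : f ∈ MvPolynomial.supported K (Z : Set σ)) (c : K) :
    ((f * monomial a c).support : Set (σ →₀ ℕ)) ⊆ expCone a Z := by
  classical
  intro b hb
  rw [Finset.mem_coe, mem_support_iff, coeff_mul_monomial'] at hb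
  split_ifs at hb with hab
  · refine ⟨hab, fun i hi => ?_⟩
    have h1 : b - a ∈ f.support := mem_support_iff.2 (left_ne_zero_of_mul hb)
    have h2 : i ∉ (b - a).support := fun h =>
      hi (mem_supported.1 hf ((mem_vars_iff_mem_support i).2 ⟨_, h1, h⟩))
    have h3 := Finsupp.notMem_support_iff.1 h2
    have h4 := hab i
    rw [Finsupp.tsub_apply] at h3
    omega
  · exact absurd rfl hb

lemma mem_stanleySpace_ideal {T : Ideal (MvPolynomial σ K)} {a : σ →₀ ℕ}
    (ha : monomial a 1 ∈ T) {Z : Finset σ} {v : T}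
    (hv : v ∈ stanleySpace (K := K) (⟨monomial a 1, ha⟩ : T) Z) :
    (v : MvPolynomial σ K) ∈ restrictSupport K (expCone a Z) := by
  obtain ⟨f, hf, rfl⟩ := mem_stanleySpace.1 hv
  exact (mem_restrictSupport_iff K).2 (support_mul_monomial_subset hf 1)

/-- The apex monomials generate the Stanley spaces. Disjoint cones give independence through
disjoint supports, and covering gives spanning monomial by monomial. -/
lemma HasConePartition.le_sdepth {T : Ideal (MvPolynomial σ K)}
    (hT : ∀ f ∈ T, ∀ b ∈ f.support, b ∈ exps T) {k : ℕ} (h : HasConePartition (exps T) k) :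
    (k : ℕ∞) ≤ sdepth (idealGrading T) := by
  classical
  obtain ⟨r, a, Z, hk, hA, hP⟩ := h
  have ha : ∀ i, monomial (a i) (1 : K) ∈ T := fun i => hA i (self_mem_expCone _ _)
  have hint : DirectSum.IsInternal fun i =>
      stanleySpace (K := K) (⟨monomial (a i) 1, ha i⟩ : T) (Z i) := by
    rw [DirectSum.isInternal_submodule_iff_iSupIndep_and_iSup_eq_top]
    constructor
    · intro i
      rw [Submodule.disjoint_def]
      intro v hv hv'
      have h1 := mem_stanleySpace_ideal (ha i) hv
      have h2 : (⨆ (j) (_ : j ≠ i),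
          stanleySpace (K := K) (⟨monomial (a j) 1, ha j⟩ : T) (Z j)) ≤
            Submodule.comap (T.subtype.restrictScalars K)
              (restrictSupport K (⋃ (j) (_ : j ≠ i), expCone (a j) (Z j))) := by
        refine iSup₂_le fun j hj w hw => ?_
        exact restrictSupport_mono K (Set.subset_iUnion₂ (s := fun j (_ : j ≠ i) =>
          expCone (a j) (Z j)) j hj) (mem_stanleySpace_ideal (ha j) hw)
      have h3 := h2 hv'
      rw [Submodule.mem_comap, mem_restrictSupport_iff] at h3
      rw [mem_restrictSupport_iff] at h1
      refine Subtype.ext (support_eq_empty.1 (Finset.eq_empty_of_forall_notMem fun b hb => ?_))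
      obtain ⟨j, hj, hbj⟩ := Set.mem_iUnion₂.1 (h3 hb)
      exact hj ((hP b (hA i (h1 hb))).unique hbj (h1 hb))
    · rw [eq_top_iff]
      rintro ⟨f, hf⟩ -
      have hmon : ∀ b ∈ f.support, monomial b (f.coeff b) ∈ T := fun b hb =>
        (monomial_mem_iff (mem_support_iff.1 hb)).2 (hT f hf b hb)
      have hsum : (⟨f, hf⟩ : T) = ∑ b ∈ f.support.attach,
          ⟨monomial b.1 (f.coeff b.1), hmon b.1 b.2⟩ := by
        refine Subtype.ext ?_
        rw [AddSubmonoidClass.coe_finsetSum]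
        exact f.as_sum.trans (Finset.sum_attach _ _).symm
      rw [hsum]
      refine Submodule.sum_mem _ fun b _ => ?_
      obtain ⟨i, hi, -⟩ := hP b.1 (hT f hf b.1 b.2)
      refine Submodule.mem_iSup_of_mem i (mem_stanleySpace.2
        ⟨_, monomial_sub_mem_supported hi (f.coeff b.1), Subtype.ext ?_⟩)
      change monomial (b.1 - a i) (f.coeff b.1) * monomial (a i) 1 = _
      rw [monomial_mul, mul_one, tsub_add_cancel_of_le hi.1]
  let D : StanleyDecomposition (idealGrading T) :=
    { r := r
      m := fun i => ⟨monomial (a i) 1, ha i⟩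
      Z := Z
      homogeneous := fun i => ⟨a i, ⟨1, rfl⟩⟩
      free := fun i f _ hf => by
        have := congrArg Subtype.val hf
        change f * monomial (a i) 1 = 0 at this
        exact (mul_eq_zero.1 this).resolve_right (by simp)
      isInternal := hint }
  refine le_trans ?_ (le_iSup (fun D : StanleyDecomposition (idealGrading T) => D.sdepth) D)
  exact le_iInf fun i => by exact_mod_cast hk i

/-- Each generator is the class of a nonzero multiple of a monomial. Freeness keeps its cone outside
`U`, spanning makes the cones cover, and independence makes them disjoint. -/
lemma StanleyDecomposition.hasConePartition {U V : Ideal (MvPolynomial σ K)}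
    (hU : ∀ f ∈ U, ∀ b ∈ f.support, b ∈ exps U)
    (D : StanleyDecomposition (factorGrading U V)) {k : ℕ} (hk : (k : ℕ∞) ≤ D.sdepth) :
    HasConePartition (exps V \ exps U) k := by
  classical
  have hD := (DirectSum.isInternal_submodule_iff_iSupIndep_and_iSup_eq_top _).1 D.isInternal
  have hm : ∀ i, ∃ (a : σ →₀ ℕ) (c : K) (h : monomial a c ∈ V), c ≠ 0 ∧
      D.m i = Submodule.Quotient.mk ⟨monomial a c, h⟩ := by
    intro i
    obtain ⟨a, v, ⟨c, hc⟩, hv⟩ := D.homogeneous i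
    have hc' : monomial a c = (v : MvPolynomial σ K) := hc
    have hv' : Submodule.Quotient.mk v = D.m i := hv
    refine ⟨a, c, hc' ▸ v.2, ?_, ?_⟩
    · rintro rfl
      rw [map_zero] at hc'
      have h0 : v = 0 := Subtype.ext hc'.symm
      rw [h0, Submodule.Quotient.mk_zero] at hv'
      exact one_ne_zero (D.free i 1 (one_mem _) (by rw [← hv', smul_zero]))
    · rw [← hv']
      congr 1
      exact Subtype.ext hc'.symm
  choose a c hV hc hm using hm
  have hsmul : ∀ i f, f • D.m i = Submodule.Quotient.mk (p := Submodule.submoduleOf U V)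
      ⟨f * monomial (a i) (c i), V.mul_mem_left f (hV i)⟩ := fun i f => by
    rw [hm i, ← Submodule.Quotient.mk_smul]; rfl
  have hcone : ∀ i, expCone (a i) (D.Z i) ⊆ exps V \ exps U := by
    intro i b hb
    have hmul : monomial (b - a i) (1 : K) * monomial (a i) (c i) = monomial b (c i) := by
      rw [monomial_mul, one_mul, tsub_add_cancel_of_le hb.1]
    refine ⟨(monomial_mem_iff (hc i)).1 (hmul ▸ V.mul_mem_left _ (hV i)), fun hbU => ?_⟩
    have h0 := D.free i _ (monomial_sub_mem_supported hb 1) (by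
      rw [hsmul, Submodule.Quotient.mk_eq_zero]
      change _ * _ ∈ U
      rw [hmul]
      exact (monomial_mem_iff (hc i)).2 hbU)
    simp at h0
  have hmem : ∀ i, ∀ b ∈ expCone (a i) (D.Z i), ∀ h : monomial b (1 : K) ∈ V,
      (Submodule.Quotient.mk ⟨monomial b 1, h⟩ : Factor U V) ∈
        stanleySpace (K := K) (D.m i) (D.Z i) := by
    intro i b hb h
    refine mem_stanleySpace.2 ⟨_, monomial_sub_mem_supported hb (c i)⁻¹, ?_⟩
    rw [hsmul]
    congr 2
    rw [monomial_mul, inv_mul_cancel₀ (hc i), tsub_add_cancel_of_le hb.1]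
  refine ⟨D.r, a, D.Z, fun i => by exact_mod_cast hk.trans (iInf_le _ i), hcone,
    fun b hb => ?_⟩
  have hne : (Submodule.Quotient.mk ⟨monomial b 1, hb.1⟩ : Factor U V) ≠ 0 := fun h =>
    hb.2 ((Submodule.Quotient.mk_eq_zero (Submodule.submoduleOf U V)).1 h)
  refine existsUnique_of_exists_of_unique ?_ fun i j hi hj => ?_
  · by_contra! hb'
    -- If no cone contains `b`, every Stanley space lifts to polynomials without an `x^b` term. Then
    -- `x^b` is congruent to such a polynomial modulo `U`, which forces `b ∈ exps U`.
    let W : Submodule K V := (LinearMap.ker (lcoeff K b)).comap (V.subtype.restrictScalars K)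
    have hW : ⨆ i, stanleySpace (K := K) (D.m i) (D.Z i) ≤
        W.map ((Submodule.mkQ (Submodule.submoduleOf U V)).restrictScalars K) := by
      refine iSup_le fun i v hv => ?_
      obtain ⟨f, hf, rfl⟩ := mem_stanleySpace.1 hv
      rw [hsmul]
      refine ⟨_, ?_, rfl⟩
      change coeff b (f * _) = 0
      by_contra h
      exact hb' i (support_mul_monomial_subset hf (c i) (mem_support_iff.2 h))
    obtain ⟨w, hw, hw'⟩ := hW (hD.2 ▸ Submodule.mem_top :
      (Submodule.Quotient.mk ⟨monomial b 1, hb.1⟩ : Factor U V) ∈ _)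
    have hsub : (w : MvPolynomial σ K) - monomial b 1 ∈ U :=
      (Submodule.Quotient.eq (Submodule.submoduleOf U V)).1 hw'
    refine hb.2 (hU _ hsub b (mem_support_iff.2 ?_))
    have hw0 : coeff b (w : MvPolynomial σ K) = 0 := hw
    rw [coeff_sub, hw0, coeff_monomial, if_pos rfl]
    simp
  · by_contra hij
    have hdis := hD.1.pairwiseDisjoint hij
    exact hne ((Submodule.disjoint_def.1 hdis) _ (hmem i b hi hb.1) (hmem j b hj hb.1))

/-- A squarefree factor of Stanley depth at least `k` has a cone partition with cones of
dimension at least `k`. -/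
lemma hasConePartition_of_le_sdepth [Finite σ] {U V : Ideal (MvPolynomial σ K)}
    (hU : IsSquarefreeMonomialIdeal U) (hV : IsSquarefreeMonomialIdeal V) {k : ℕ}
    (hk : (k : ℕ∞) ≤ sdepth (factorGrading U V)) : HasConePartition (exps V \ exps U) k := by
  rcases k with _ | k
  · exact hasConePartition_zero fun b c hbc hb =>
      ⟨hV.mem_exps_of_support_subset hb.1 hbc.subset,
        fun hc => hb.2 (hU.mem_exps_of_support_subset hc hbc.symm.subset)⟩
  · have : (k : ℕ∞) < sdepth (factorGrading U V) :=
      lt_of_lt_of_le (by exact_mod_cast Nat.lt_succ_self k) hk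
    obtain ⟨D, hD⟩ := lt_iSup_iff.1 this
    refine D.hasConePartition (fun f hf => hU.mem_iff.1 hf) ?_
    rw [Nat.cast_succ]
    exact Order.add_one_le_of_lt hD

end StanleyPartition

/-! ### Depth over polynomial rings. -/

section PolynomialDepth

open MvPolynomial RingTheory.Sequence

variable {σ K : Type*} [Field K]

lemma coeff_zero_eq_zero_of_mem_idealOfVars {f : MvPolynomial σ K} (hf : f ∈ idealOfVars σ K) :
    coeff 0 f = 0 := by
  rw [idealOfVars, ← Set.image_univ, mem_ideal_span_X_image] at hf
  by_contra h
  obtain ⟨i, -, hi⟩ := hf 0 (mem_support_iff.2 h)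
  exact hi rfl

/-- Weakly regular becomes regular by Nakayama: otherwise some `r` with constant term 1 kills `V/U`.
Then `r x^b ∈ U` has an `x^b` term for each `x^b ∈ V`, so `V ≤ U`. -/
lemma le_polyDepth_factor [Finite σ] {U V : Ideal (MvPolynomial σ K)}
    (hU : IsSquarefreeMonomialIdeal U) (hV : IsSquarefreeMonomialIdeal V) (hUV : U < V) {k : ℕ}
    (h : DepthGE (idealOfVars σ K) V k U) : (k : ℕ∞) ≤ polyDepth σ K (Factor U V) := by
  obtain ⟨rs, hl, hrs, hw⟩ := (depthGE_iff_exists_isWeaklyRegular k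
    (Submodule.mkQ (Submodule.submoduleOf U V)) (Submodule.mkQ_surjective _) fun x => by
      rw [Submodule.mkQ_apply, Submodule.Quotient.mk_eq_zero]; rfl).1 h
  have htop : (⊤ : Submodule (MvPolynomial σ K) (Factor U V)) ≠ Ideal.ofList rs • ⊤ := by
    intro htop
    have hle : Ideal.ofList rs ≤ idealOfVars σ K := Ideal.span_le.2 hrs
    obtain ⟨r, hr, hr0⟩ := Submodule.exists_sub_one_mem_and_smul_eq_zero_of_fg_of_le_smul
      (idealOfVars σ K) (⊤ : Submodule (MvPolynomial σ K) (Factor U V)) Module.Finite.fg_top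
      (htop.le.trans (Submodule.smul_mono_left hle))
    refine hUV.not_ge ((hV.le_iff hU).2 fun b hb => ?_)
    have hbU : r * monomial b 1 ∈ U :=
      (Submodule.Quotient.mk_eq_zero (Submodule.submoduleOf U V) 
        (x := r • (⟨monomial b 1, hb⟩ : V))).1
        (hr0 (Submodule.Quotient.mk ⟨monomial b 1, hb⟩) trivial)
    refine hU.mem_iff.1 hbU b (mem_support_iff.2 ?_)
    have h1 := coeff_zero_eq_zero_of_mem_idealOfVars hr
    rw [coeff_sub, coeff_zero_one, sub_eq_zero] at h1
    simp [coeff_mul_monomial', h1]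
  rw [← hl]
  exact le_iSup₂_of_le (f := fun (rs : List (MvPolynomial σ K)) _ => (rs.length : ℕ∞)) rs
    ⟨hrs, hw, htop⟩ le_rfl

lemma regularOn_span_X {s : Finset σ} {j : σ} (hj : j ∉ s) :
    RegularOn ⊤ (Ideal.span (X '' (s : Set σ)) : Ideal (MvPolynomial σ K)) (X j) := by
  classical
  intro f _ hf
  rw [smul_eq_mul, mem_ideal_span_X_image] at hf
  rw [mem_ideal_span_X_image]
  intro m hm
  obtain ⟨i, hi, hmi⟩ := hf (Finsupp.single j 1 + m) (by
    rw [mem_support_iff, coeff_X_mul]; exact mem_support_iff.1 hm)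
  refine ⟨i, hi, ?_⟩
  have : j ≠ i := fun h => hj (h ▸ hi)
  simpa [Finsupp.single_apply, this] using hmi

lemma depthGE_span_X [Fintype σ] [DecidableEq σ] : ∀ (k : ℕ) (s : Finset σ), sᶜ.card = k →
    DepthGE (idealOfVars σ K) ⊤ k (Ideal.span (X '' (s : Set σ)))
  | 0, _, _ => trivial
  | k + 1, s, hs => by
    obtain ⟨j, hj⟩ : sᶜ.Nonempty := Finset.card_pos.1 (by omega)
    have hjs : j ∉ s := Finset.mem_compl.1 hj
    refine ⟨X j, Ideal.subset_span ⟨j, rfl⟩, regularOn_span_X hjs, ?_⟩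
    have h := depthGE_span_X k (insert j s) (by
      rw [Finset.compl_insert, Finset.card_erase_of_mem hj, hs, Nat.add_sub_cancel])
    have heq : (Ideal.span (X '' (s : Set σ)) ⊔ (X j : MvPolynomial σ K) • ⊤ :
        Ideal (MvPolynomial σ K)) = Ideal.span (X '' ((insert j s : Finset σ) : Set σ)) := by
      rw [← Submodule.ideal_span_singleton_smul, smul_eq_mul, Ideal.mul_top, ← Ideal.span_union,
        Finset.coe_insert, Set.image_insert_eq, Set.union_singleton]
    rwa [heq]

lemma depthGE_top_bot (n : ℕ) : DepthGE (idealOfVars (Fin n) K) ⊤ n (⊥ : Ideal (MvPolynomial (Fin n) K)) := by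
  have h := depthGE_span_X (K := K) n (∅ : Finset (Fin n)) (by simp)
  simpa using h

/-- Any nonzero `f ∈ T` is a nonzerodivisor, so `dim S/T ≤ dim S/(f) ≤ n`. -/
lemma length_le_of_isRegular_quotient {n : ℕ} {T : Ideal (MvPolynomial (Fin (n + 1)) K)}
    (hT : T ≠ ⊥) {rs : List (MvPolynomial (Fin (n + 1)) K)}
    (h : IsRegular (MvPolynomial (Fin (n + 1)) K ⧸ T) rs) : rs.length ≤ n := by
  have h1 := length_le_supportDim rs h
  obtain ⟨f, hf, hf0⟩ := Submodule.exists_mem_ne_zero_of_ne_bot hT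
  have h2 : ringKrullDim (MvPolynomial (Fin (n + 1)) K ⧸ T) ≤
      ringKrullDim (MvPolynomial (Fin (n + 1)) K ⧸ Ideal.span {f}) :=
    ringKrullDim_le_of_surjective
      (Ideal.Quotient.factor ((Ideal.span_singleton_le_iff_mem T).2 hf))
      (Ideal.Quotient.factor_surjective _)
  have h3 := ringKrullDim_quotient_succ_le_of_nonZeroDivisor (mem_nonZeroDivisors_of_ne_zero hf0)
  rw [ringKrullDim_of_isNoetherianRing, ringKrullDim_eq_zero_of_field, zero_add,
    Nat.card_eq_fintype_card, Fintype.card_fin] at h3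
  rw [Module.supportDim_quotient_eq_ringKrullDim] at h1
  have h4 : ((rs.length + 1 : ℕ) : WithBot ℕ∞) ≤ ((n + 1 : ℕ) : WithBot ℕ∞) := by
    refine le_trans ?_ h3
    rw [Nat.cast_add, Nat.cast_one]
    gcongr
    exact h1.trans h2
  have h5 : rs.length + 1 ≤ n + 1 := by exact_mod_cast h4
  omega

lemma depthGE_of_le_polyDepth_quotient {n : ℕ} {T : Ideal (MvPolynomial (Fin (n + 1)) K)}
    (hT : T ≠ ⊥) {k : ℕ}
    (hk : (k : ℕ∞) ≤ polyDepth (Fin (n + 1)) K (MvPolynomial (Fin (n + 1)) K ⧸ T)) :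
    DepthGE (idealOfVars (Fin (n + 1)) K) ⊤ k T ∧ k ≤ n := by
  rcases k with _ | k
  · exact ⟨trivial, Nat.zero_le n⟩
  have hlt : (k : ℕ∞) < polyDepth (Fin (n + 1)) K (MvPolynomial (Fin (n + 1)) K ⧸ T) :=
    lt_of_lt_of_le (by exact_mod_cast Nat.lt_succ_self k) hk
  obtain ⟨rs, hrs⟩ := lt_iSup_iff.1 hlt
  obtain ⟨hrs, hl⟩ := lt_iSup_iff.1 hrs
  have hl : k + 1 ≤ rs.length := by exact_mod_cast hl
  refine ⟨DepthGE.mono hl ?_, hl.trans (length_le_of_isRegular_quotient hT hrs.2)⟩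
  refine (depthGE_iff_exists_isWeaklyRegular rs.length
    ((Submodule.mkQ T).comp (Submodule.subtype ⊤)) ?_ fun x => ?_).2
      ⟨rs, rfl, hrs.1, hrs.2.toIsWeaklyRegular⟩
  · intro y
    obtain ⟨y, rfl⟩ := Submodule.mkQ_surjective T y
    exact ⟨⟨y, trivial⟩, rfl⟩
  · rw [LinearMap.comp_apply, Submodule.mkQ_apply, Submodule.Quotient.mk_eq_zero]
    rfl

end PolynomialDepth

/-! ### Slicing an ideal along the variable `x₀`. -/

section Hyperplane

open MvPolynomial

variable {K : Type*} [Field K] {n : ℕ}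

/-- `T` is the ideal `U + x₀ V`. -/
def IsConeIdeal (U V : Ideal (MvPolynomial (Fin n) K))
    (T : Ideal (MvPolynomial (Fin (n + 1)) K)) : Prop :=
  ∀ f, f ∈ T ↔ (finSuccEquiv K n f).coeff 0 ∈ U ∧ ∀ j, (finSuccEquiv K n f).coeff j ∈ V

lemma support_cons_subset {k : ℕ} {b c : Fin n →₀ ℕ} (h : b.support ⊆ c.support) :
    (b.cons k).support ⊆ (c.cons k).support := by
  intro i hi
  rw [Finsupp.mem_support_iff] at hi ⊢
  induction i using Fin.cases with
  | zero => simpa using hi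
  | succ i =>
    rw [Finsupp.cons_succ] at hi ⊢
    exact Finsupp.mem_support_iff.1 (h (Finsupp.mem_support_iff.2 hi))

/-- Here `U` is the slice of `T` at `x₀`-degree 0 and `V` the slice at degree 1. Membership depends
only on supports, so all positive degrees have the same slice. -/
lemma IsSquarefreeMonomialIdeal.exists_exps_eq_cons
    {T : Ideal (MvPolynomial (Fin (n + 1)) K)} (hT : IsSquarefreeMonomialIdeal T) :
    ∃ U V : Ideal (MvPolynomial (Fin n) K), IsSquarefreeMonomialIdeal U ∧
      IsSquarefreeMonomialIdeal V ∧ exps U ⊆ exps V ∧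
      exps T = {b | b.tail ∈ exps V ∧ (b 0 = 0 → b.tail ∈ exps U)} := by
  obtain ⟨U, hU, hU'⟩ := exists_isSquarefreeMonomialIdeal_exps_eq (K := K)
    (B := {b | b.cons 0 ∈ exps T}) fun b c hb h =>
      hT.mem_exps_of_support_subset hb (support_cons_subset h)
  obtain ⟨V, hV, hV'⟩ := exists_isSquarefreeMonomialIdeal_exps_eq (K := K)
    (B := {b | b.cons 1 ∈ exps T}) fun b c hb h =>
      hT.mem_exps_of_support_subset hb (support_cons_subset h)
  have hsub : ∀ b : Fin (n + 1) →₀ ℕ, b.support ⊆ (b.tail.cons 1).support := by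
    intro b i hi
    rw [Finsupp.mem_support_iff] at hi ⊢
    induction i using Fin.cases with
    | zero => simp
    | succ i => rwa [Finsupp.cons_succ, Finsupp.tail_apply]
  refine ⟨U, V, hU, hV, ?_, ?_⟩
  · rw [hU', hV']
    intro b hb
    have := hT.mem_exps_of_support_subset hb (hsub _)
    rwa [Finsupp.tail_cons] at this
  · rw [hU', hV']
    ext b
    constructor
    · intro hb
      refine ⟨hT.mem_exps_of_support_subset hb (hsub b), fun h0 => ?_⟩
      change b.tail.cons 0 ∈ exps T
      rwa [← h0, Finsupp.cons_tail]
    · rintro ⟨h1, h2⟩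
      by_cases h0 : b 0 = 0
      · have := h2 h0
        change b.tail.cons 0 ∈ exps T at this
        rwa [← h0, Finsupp.cons_tail] at this
      · refine hT.mem_exps_of_support_subset h1 fun i hi => ?_
        rw [Finsupp.mem_support_iff] at hi ⊢
        induction i using Fin.cases with
        | zero => exact h0
        | succ i => rwa [Finsupp.cons_succ, Finsupp.tail_apply] at hi

lemma isConeIdeal_of_exps_eq {U V : Ideal (MvPolynomial (Fin n) K)}
    {T : Ideal (MvPolynomial (Fin (n + 1)) K)} (hU : IsSquarefreeMonomialIdeal U)
    (hV : IsSquarefreeMonomialIdeal V) (hT : IsSquarefreeMonomialIdeal T)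
    (h : exps T = {b | b.tail ∈ exps V ∧ (b 0 = 0 → b.tail ∈ exps U)}) : IsConeIdeal U V T := by
  intro f
  rw [hT.mem_iff, hU.mem_iff, h]
  simp only [hV.mem_iff, mem_support_iff, finSuccEquiv_coeff_coeff]
  constructor
  · intro hf
    refine ⟨fun b hb => ?_, fun j b hb => ?_⟩
    · simpa using (hf _ hb).2
    · simpa using (hf _ hb).1
  · rintro ⟨h0, h1⟩ b hb
    refine ⟨h1 (b 0) _ (by rwa [Finsupp.cons_tail]), fun hb0 => h0 _ ?_⟩
    rwa [← hb0, Finsupp.cons_tail]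

variable {U V : Ideal (MvPolynomial (Fin n) K)} {T : Ideal (MvPolynomial (Fin (n + 1)) K)}

/-- This is `x₀T = x₀U + x₀²V`, so `T/x₀T` has only the two pieces `U` and `x₀(V/U)`. The summand
`⊥` matches the recursion of `DepthGE`. -/
lemma IsConeIdeal.mem_X_smul_iff (hT : IsConeIdeal U V T)
    {f : MvPolynomial (Fin (n + 1)) K} :
    f ∈ ⊥ ⊔ (X 0 : MvPolynomial (Fin (n + 1)) K) • T ↔
      (finSuccEquiv K n f).coeff 0 = 0 ∧ (finSuccEquiv K n f).coeff 1 ∈ U ∧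
        ∀ j, (finSuccEquiv K n f).coeff (j + 1) ∈ V := by
  rw [mem_sup_smul_iff]
  simp only [Submodule.mem_bot, sub_eq_zero, smul_eq_mul]
  constructor
  · rintro ⟨g, hg, rfl⟩
    rw [map_mul, finSuccEquiv_X_zero]
    have hg' := (hT g).1 hg
    refine ⟨by simp, ?_, fun j => ?_⟩
    · exact (Polynomial.coeff_X_mul (finSuccEquiv K n g) 0).symm ▸ hg'.1
    · rw [Polynomial.coeff_X_mul]
      exact hg'.2 j
  · rintro ⟨h0, h1, h2⟩
    refine ⟨(finSuccEquiv K n).symm (finSuccEquiv K n f).divX, (hT _).2 ?_,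
      (finSuccEquiv K n).injective ?_⟩
    · rw [AlgEquiv.apply_symm_apply]
      exact ⟨by simpa [Polynomial.coeff_divX] using h1,
        fun j => by simpa [Polynomial.coeff_divX] using h2 j⟩
    · rw [map_mul, finSuccEquiv_X_zero, AlgEquiv.apply_symm_apply]
      conv_lhs => rw [← Polynomial.X_mul_divX_add (finSuccEquiv K n f), h0, map_zero, add_zero]

/-- The substitution `x₀ ↦ 0`. -/
def substZero (K : Type*) [Field K] (n : ℕ) :
    MvPolynomial (Fin (n + 1)) K →+* MvPolynomial (Fin n) K :=
  Polynomial.constantCoeff.comp (finSuccEquiv K n : MvPolynomial (Fin (n + 1)) K →+* _)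

lemma substZero_apply (f : MvPolynomial (Fin (n + 1)) K) :
    substZero K n f = (finSuccEquiv K n f).coeff 0 := rfl

lemma substZero_mem_idealOfVars {f : MvPolynomial (Fin (n + 1)) K}
    (hf : f ∈ idealOfVars (Fin (n + 1)) K) : substZero K n f ∈ idealOfVars (Fin n) K := by
  have : idealOfVars (Fin (n + 1)) K ≤ (idealOfVars (Fin n) K).comap (substZero K n) := by
    refine Ideal.span_le.2 ?_
    rintro _ ⟨i, rfl⟩
    rw [SetLike.mem_coe, Ideal.mem_comap, substZero_apply]
    induction i using Fin.cases with
    | zero => simp [finSuccEquiv_X_zero]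
    | succ i =>
      rw [finSuccEquiv_X_succ, Polynomial.coeff_C_zero]
      exact Ideal.subset_span ⟨i, rfl⟩
  exact this hf

/-- The coefficient of `x₀ ^ j`. -/
def varCoeff (K : Type*) [Field K] (n j : ℕ) :
    MvPolynomial (Fin (n + 1)) K →+ MvPolynomial (Fin n) K :=
  (Polynomial.lcoeff (MvPolynomial (Fin n) K) j).toAddMonoidHom.comp
    (finSuccEquiv K n : MvPolynomial (Fin (n + 1)) K →+* _).toAddMonoidHom

lemma varCoeff_apply (j : ℕ) (f : MvPolynomial (Fin (n + 1)) K) :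
    varCoeff K n j f = (finSuccEquiv K n f).coeff j := rfl

/-- The map `f ↦ x₀ ^ j f`. -/
def varMonomial (K : Type*) [Field K] (n j : ℕ) :
    MvPolynomial (Fin n) K →+ MvPolynomial (Fin (n + 1)) K :=
  ((finSuccEquiv K n).symm : _ →+* MvPolynomial (Fin (n + 1)) K).toAddMonoidHom.comp
    (Polynomial.monomial j).toAddMonoidHom

lemma finSuccEquiv_varMonomial (j : ℕ) (f : MvPolynomial (Fin n) K) :
    finSuccEquiv K n (varMonomial K n j f) = Polynomial.monomial j f :=
  (finSuccEquiv K n).apply_symm_apply _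

/-- On `T/x₀T` scalars act through `x₀ ↦ 0`, and `U` is its retract in `x₀`-degree 0. -/
lemma IsConeIdeal.depthGE_left (hT : IsConeIdeal U V T) (hUV : U ≤ V) {k : ℕ}
    (h : DepthGE (idealOfVars (Fin (n + 1)) K) T k
      (⊥ ⊔ (X 0 : MvPolynomial (Fin (n + 1)) K) • T)) :
    DepthGE (idealOfVars (Fin n) K) U k ⊥ := by
  refine DepthGE.retract (substZero K n) (fun r => substZero_mem_idealOfVars)
    (varMonomial K n 0) (varCoeff K n 0) ?_ ?_ ?_ k ?_ ?_ ?_ ?_ h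
  · intro y hy
    rw [hT, finSuccEquiv_varMonomial]
    refine ⟨by simpa using hy, fun j => ?_⟩
    rw [Polynomial.coeff_monomial]
    split_ifs
    exacts [hUV hy, V.zero_mem]
  · exact fun m hm => ((hT m).1 hm).1
  · intro y _
    simp [varCoeff_apply, finSuccEquiv_varMonomial]
  · rintro y rfl
    rw [map_zero]
    exact Submodule.zero_mem _
  · exact fun m hm => ((hT.mem_X_smul_iff).1 hm).1
  · intro r y hy
    rw [hT.mem_X_smul_iff, map_sub, smul_eq_mul, smul_eq_mul, map_mul (finSuccEquiv K n),
      finSuccEquiv_varMonomial, finSuccEquiv_varMonomial, Polynomial.monomial_zero_left,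
      Polynomial.monomial_zero_left]
    simp only [Polynomial.coeff_sub, Polynomial.coeff_mul_C, Polynomial.coeff_C, substZero_apply]
    exact ⟨by simp, by simpa using U.mul_mem_left _ hy,
      fun j => by simpa using V.mul_mem_left _ (hUV hy)⟩
  · intro r m _
    simp [varCoeff_apply, substZero_apply, Polynomial.mul_coeff_zero]

/-- The factor `V/U` is the retract of `T/x₀T` in `x₀`-degree 1. -/
lemma IsConeIdeal.depthGE_factor (hT : IsConeIdeal U V T) (hUV : U ≤ V) {k : ℕ}
    (h : DepthGE (idealOfVars (Fin (n + 1)) K) T k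
      (⊥ ⊔ (X 0 : MvPolynomial (Fin (n + 1)) K) • T)) :
    DepthGE (idealOfVars (Fin n) K) V k U := by
  refine DepthGE.retract (substZero K n) (fun r => substZero_mem_idealOfVars)
    (varMonomial K n 1) (varCoeff K n 1) ?_ ?_ ?_ k ?_ ?_ ?_ ?_ h
  · intro y hy
    rw [hT, finSuccEquiv_varMonomial]
    refine ⟨by simp [Polynomial.coeff_monomial], fun j => ?_⟩
    rw [Polynomial.coeff_monomial]
    split_ifs
    exacts [hy, V.zero_mem]
  · exact fun m hm => ((hT m).1 hm).2 1
  · intro y _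
    simp [varCoeff_apply, finSuccEquiv_varMonomial]
  · intro y hy
    rw [hT.mem_X_smul_iff, finSuccEquiv_varMonomial]
    refine ⟨by simp [Polynomial.coeff_monomial], by simpa using hy, fun j => ?_⟩
    rw [Polynomial.coeff_monomial]
    split_ifs
    exacts [hUV hy, V.zero_mem]
  · exact fun m hm => ((hT.mem_X_smul_iff).1 hm).2.1
  · intro r y hy
    rw [hT.mem_X_smul_iff, map_sub, smul_eq_mul, smul_eq_mul, map_mul (finSuccEquiv K n),
      finSuccEquiv_varMonomial, finSuccEquiv_varMonomial]
    refine ⟨?_, ?_, fun j => ?_⟩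
    · simp [Polynomial.mul_coeff_zero, Polynomial.coeff_monomial]
    · rw [Polynomial.coeff_sub, Polynomial.coeff_monomial, if_pos rfl,
        Polynomial.coeff_mul_monomial _ 1 0, substZero_apply, sub_self]
      exact U.zero_mem
    · rw [Polynomial.coeff_sub, Polynomial.coeff_mul_monomial, Polynomial.coeff_monomial]
      refine V.sub_mem ?_ (V.mul_mem_left _ hy)
      split_ifs
      exacts [V.mul_mem_left _ hy, V.zero_mem]
  -- The defect of semilinearity is the `x₀`-coefficient of `r` times the constant coefficient of
  -- `m`, which lies in `U`.
  · intro r m hm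
    rw [varCoeff_apply, varCoeff_apply, substZero_apply, smul_eq_mul, smul_eq_mul, map_mul,
      Polynomial.mul_coeff_one, add_sub_cancel_left]
    exact U.mul_mem_left _ ((hT m).1 hm).1

end Hyperplane

/-! ### The inductive step and the two inequalities. -/

section Main

open MvPolynomial

variable {K : Type*} [Field K] {n : ℕ}

lemma hasConePartition_of_depthGE
    (hconj : ∀ U V : Ideal (MvPolynomial (Fin n) K),
      IsSquarefreeMonomialIdeal U → IsSquarefreeMonomialIdeal V → U < V →
        polyDepth (Fin n) K (Factor U V) ≤ sdepth (factorGrading U V))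
    {U V : Ideal (MvPolynomial (Fin n) K)} (hU : IsSquarefreeMonomialIdeal U)
    (hV : IsSquarefreeMonomialIdeal V) (hUV : U ≤ V) {k : ℕ}
    (h : DepthGE (idealOfVars (Fin n) K) V k U) : HasConePartition (exps V \ exps U) k := by
  rcases hUV.eq_or_lt with rfl | hlt
  -- For `U = V` the hypothesis says nothing, but the set to partition is empty.
  · rw [Set.sdiff_self]
    exact hasConePartition_empty k
  · exact hasConePartition_of_le_sdepth hU hV
      ((le_polyDepth_factor hU hV hlt h).trans (hconj U V hU hV hlt))

lemma le_sdepth_of_depthGE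
    (hconj : ∀ U V : Ideal (MvPolynomial (Fin n) K),
      IsSquarefreeMonomialIdeal U → IsSquarefreeMonomialIdeal V → U < V →
        polyDepth (Fin n) K (Factor U V) ≤ sdepth (factorGrading U V))
    {T : Ideal (MvPolynomial (Fin (n + 1)) K)} (hT : IsSquarefreeMonomialIdeal T) {k : ℕ}
    (h : DepthGE (idealOfVars (Fin (n + 1)) K) T (k + 1) ⊥) :
    ((k + 1 : ℕ) : ℕ∞) ≤ sdepth (idealGrading T) := by
  obtain ⟨U, V, hU, hV, hUV, hexp⟩ := hT.exists_exps_eq_cons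
  have hcone := isConeIdeal_of_exps_eq hU hV hT hexp
  have hUV' := (hU.le_iff hV).2 hUV
  have h1 := h.sup_smul (y := X 0) (Ideal.subset_span ⟨0, rfl⟩) fun m _ hm =>
    (mul_eq_zero.1 hm).resolve_left (X_ne_zero 0)
  have h2 := hasConePartition_of_depthGE hconj isSquarefreeMonomialIdeal_bot hU bot_le
    (hcone.depthGE_left hUV' h1)
  rw [exps_bot, Set.sdiff_empty] at h2
  have h3 := hasConePartition_of_depthGE hconj hU hV hUV' (hcone.depthGE_factor hUV' h1)
  exact HasConePartition.le_sdepth (fun f hf => hT.mem_iff.1 hf) (hexp ▸ h2.cons h3 hUV)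

end Main

end

open MvPolynomial in
theorem mainTheorem2 {K : Type*} [Field K] (n : ℕ)
    (hconj : ∀ U V : Ideal (MvPolynomial (Fin n) K),
      IsSquarefreeMonomialIdeal U → IsSquarefreeMonomialIdeal V → U < V →
        polyDepth (Fin n) K (Factor U V) ≤ sdepth (factorGrading U V)) :
    ∀ T : Ideal (MvPolynomial (Fin (n + 1)) K), IsSquarefreeMonomialIdeal T →
      (T ≠ ⊥ → polyDepth (Fin (n + 1)) K T ≤ sdepth (idealGrading T)) ∧
      (T ≠ ⊤ →
        1 + polyDepth (Fin (n + 1)) K (MvPolynomial (Fin (n + 1)) K ⧸ T)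
          ≤ sdepth (idealGrading T)) := by
  intro T hT
  constructor
  · intro _
    refine iSup₂_le fun rs hrs => ?_
    have h : DepthGE (idealOfVars (Fin (n + 1)) K) T rs.length ⊥ :=
      (depthGE_iff_exists_isWeaklyRegular rs.length LinearMap.id Function.surjective_id
        fun x => by simp).2 ⟨rs, rfl, hrs.1, hrs.2.toIsWeaklyRegular⟩
    rcases hl : rs.length with _ | d
    · simp
    · exact le_sdepth_of_depthGE hconj hT (hl ▸ h)
  · intro _
    by_cases hbot : T = ⊥
    · have htop : sdepth (idealGrading T) = ⊤ := by
        refine ENat.eq_top_iff_forall_ge.2 fun k => ?_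
        refine HasConePartition.le_sdepth (fun f hf => hT.mem_iff.1 hf) ?_
        rw [hbot, exps_bot]
        exact hasConePartition_empty k
      rw [htop]
      exact le_top
    -- The depth is an extended natural number, so the bound is tested on each finite `m`.
    refine ENat.forall_natCast_le_iff_le.1 fun m hm => ?_
    rcases m with _ | k
    · simp
    have hk : (k : ℕ∞) ≤ polyDepth (Fin (n + 1)) K (MvPolynomial (Fin (n + 1)) K ⧸ T) := by
      rw [Nat.cast_add, Nat.cast_one, add_comm] at hm
      exact (ENat.add_le_add_iff_left ENat.one_ne_top).1 hm
    obtain ⟨h, hkn⟩ := depthGE_of_le_polyDepth_quotient hbot hk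
    -- The depth lemma needs depth at least `k + 1` for `S` itself; this is available because `T ≠
    -- ⊥` forces `k ≤ n`.
    have h' := DepthGE.of_quotient (P := T) k (Q := ⊥) (by rwa [sup_bot_eq])
      ((depthGE_top_bot (n + 1)).mono (by omega))
    rw [inf_bot_eq] at h'
    exact le_sdepth_of_depthGE hconj hT h'
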